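/- **Theorem ("Main theorem of arithmetic" for $\mathcal{E}_\Sigma$).** *Setting.* Let $f_0=f_1=1$, $f_i=f_{i-1}+f_{i-2}$ $(i\ge 2)$. Every $n\in\mathbb{N}=\{0,1,2,\dots\}$ is uniquely $n=f_{i_1}+\dots+f_{i_q}$ with $i_1\ge 1$ and $i_{a+1}-i_a\ge 2$ for $1\le a<q$ (so $q=0$ for $n=0$). Put $\alpha_1=\lfloor (i_1-1)/2\rfloor+1$ and $\alpha_r=\lfloor (i_r-i_{r-1})/2\rfloor+1$ for $r>1$. Cut $(i_1,\dots,i_q)$ into its maximal runs of consecutive entries of equal parity, and cut $(\alpha_1,\dots,\alpha_q)$ at the same places into vectors $A_1,\dots,A_s$. For a vector $A=(\alpha_1,\dots,\alpha_q)$ of positive integers with $q\ge1$ and $\alpha_2,\dots,\alpha_q\ge 2$ let $$\langle A\rangle=\cfrac{1}{\alpha_1-\cfrac{1}{\alpha_2-\cdots-\cfrac{1}{\alpha_q}}}.$$ Every rational $g>0$ equals $\langle c(g)\rangle$ for exactly one such vector $c(g)$. Let $\Gamma$ be the free monoid, with product $*$, on the set of non-zero elements of $\mathbb{Q}/\mathbb{Z}$,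 identified with the rationals in $(0,1)$. Define $\pi:\mathbb{N}\to\Gamma$ by $$\pi(n)=\big(\langle A_1\rangle-\lfloor\langle A_1\rangle\rfloor\big)*\langle A_2\rangle*\dots*\langle A_s\rangle ,$$ where a first factor equal to $0$ is read as the unit, and $\pi(0)=1$. The map $\pi$ is surjective; for $\gamma\in\Gamma$ let $\theta(\gamma)$ be the lowest number in $\pi^{-1}(\gamma)$. The numbers $\theta(\gamma)$, $\gamma\in\Gamma$, are called *essential*. The essential numbers form a monoid under $\theta(\gamma_1)*\theta(\gamma_2)=\theta(\gamma_1*\gamma_2)$, with unit $\theta(1)=0$; $n^{*r}$ denotes the $r$-th power. The numbers $\theta(g)$ with $g\in\mathbb{Q}\cap(0,1)$ are called *$F$-primes*. A number $n$ is called *commutative essential* if, for some $\gamma\in\Gamma$, it is the lowest number such that the word $\pi(n)$ is obtained from the word $\gamma$ by a permutation of its letters. For distinct vectors $x,y$ of positive integers write $x\lhd y$ if, after padding the shorter one on the left by coordinates equal to $\infty$ to make the lengths equal, the coordinate of $x$ is smaller than that of $y$ at the rightmost position where they differ. For $F$-primes $n_1=\theta(g_1)$ and $n_2=\theta(g_2)$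 write $n_1\lhd n_2$ if $c(g_1)\lhd c(g_2)$. *Claim.* A number $n\in\mathbb{N}$ is commutative essential if and only if $$n=n_1^{*r_1}*\dots*n_m^{*r_m}$$ for some $m\ge 0$, some $F$-primes $n_1\lhd\dots\lhd n_m$ and some integers $r_1,\dots,r_m\ge 1$ (the empty product, $m=0$, is $0$). -/

import Mathlib

namespace FibPart

/-- The Fibonacci numbers in the normalization `f 0 = f 1 = 1`, `f i = f (i-1) + f (i-2)`. -/
def f (i : ℕ) : ℕ := Nat.fib (i + 1)

/-- The indices `μ₁ < ⋯ < μ_q` (all `≥ 1`, consecutive ones at distance at least two) of the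
minimal Fibonacci partition `n = f μ₁ + ⋯ + f μ_q`.  `Nat.zeckendorf` lists the indices of the
Zeckendorf representation in decreasing order and with respect to `Nat.fib`, so all its entries
are `≥ 2` and have to be lowered by one. -/
def Z (n : ℕ) : List ℕ := (n.zeckendorf.map fun i => i - 1).reverse

theorem sum_Z (n : ℕ) : ((Z n).map f).sum = n := by
  have h : ∀ l : List ℕ, (∀ a ∈ l, 2 ≤ a) →
      ((l.map fun i => i - 1).map f).sum = (l.map Nat.fib).sum := by
    intro l hl
    rw [List.map_map]
    congr 1
    apply List.map_congr_left
    intro a ha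
    have := hl a ha
    simp only [Function.comp, f]
    congr 1
    omega
  have key : ∀ a ∈ n.zeckendorf, 2 ≤ a := by
    have hz := Nat.isZeckendorfRep_zeckendorf n
    unfold List.IsZeckendorfRep at hz
    have hp : ((n.zeckendorf ++ [0]).Pairwise fun a b => b + 2 ≤ a) := by
      have : IsTrans ℕ (fun a b => b + 2 ≤ a) := ⟨fun a b c h1 h2 => by omega⟩
      exact List.isChain_iff_pairwise.1 hz
    rw [List.pairwise_append] at hp
    intro a ha
    have := hp.2.2 a ha 0 (by simp)
    omega
  rw [Z, List.map_reverse, List.sum_reverse, h _ key, Nat.sum_zeckendorf_fib]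

/-- Auxiliary: `⌊(i₁ - j) / 2⌋ + 1, ⌊(i₂ - i₁) / 2⌋ + 1, …` -/
def assocAux : ℕ → List ℕ → List ℕ
  | _, [] => []
  | j, i :: l => ((i - j) / 2 + 1) :: assocAux i l

/-- The associated vector `α(I)`: `α₁ = ⌊(i₁ - 1)/2⌋ + 1` and
`α_r = ⌊(i_r - i_{r-1})/2⌋ + 1` for `r > 1`. -/
def assocVector (I : List ℕ) : List ℕ := assocAux 1 I

/-- The canonical form `(I₁; …; I_s)`: the decomposition of `I` into its simple components, the
maximal runs of consecutive entries of equal parity. -/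
def canonicalForm (I : List ℕ) : List (List ℕ) := I.splitBy fun a b => a % 2 == b % 2

/-- The associated multivector `A₁ × ⋯ × A_s`: the associated vector `α(I)`, cut into pieces
whose lengths are the dimensions of the simple components of `I`. -/
def multivector (I : List ℕ) : List (List ℕ) :=
  ((canonicalForm I).map List.length).splitLengths (assocVector I)

/-- The continued fraction `⟨α₁, …, α_q⟩ = 1/(α₁ - 1/(α₂ - ⋯ - 1/α_q))`. -/
def cf : List ℕ → ℚ
  | [] => 0
  | a :: l => 1 / ((a : ℚ) - cf l)

/-- The non-zero elements of `ℚ/ℤ`, each represented by its fraction in `(0,1)`. -/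
abbrev QZ : Type := Set.Ioo (0 : ℚ) 1

/-- `Γ(ℚ/ℤ)`: the free monoid on the non-zero elements of `ℚ/ℤ`. -/
abbrev Gamma : Type := FreeMonoid QZ

/-- The element of `Γ(ℚ/ℤ)` given by the class of a rational `x` modulo `ℤ`: the generator
`x - ⌊x⌋`, or the unit if `x` is an integer. -/
def letter (x : ℚ) : Gamma :=
  if h : Int.fract x = 0 then 1
  else FreeMonoid.of ⟨Int.fract x, lt_of_le_of_ne (Int.fract_nonneg x) (Ne.symm h),
    Int.fract_lt_one x⟩

/-- The map `p(A₁ × ⋯ × A_s) = (⟨A₁⟩ - ⌊⟨A₁⟩⌋) * ⟨A₂⟩ * ⋯ * ⟨A_s⟩`.  (For the multivector of a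
2-partition, `⟨A₂⟩, …, ⟨A_s⟩` lie in `(0,1)`, so reducing them modulo `ℤ` changes nothing.) -/
def p (A : List (List ℕ)) : Gamma := (A.map fun a => letter (cf a)).prod

/-- The projection `π : ℕ → Γ(ℚ/ℤ)`. -/
def proj (n : ℕ) : Gamma := p (multivector (Z n))

/-- `n = θ(γ)`, that is, `n` is the lowest number in `π⁻¹(γ)`. -/
def IsTheta (γ : Gamma) (n : ℕ) : Prop := IsLeast {m | proj m = γ} n

/-- `θ(γ)` as a function; the map `π` is surjective, so this is the lowest number in `π⁻¹(γ)`. -/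
noncomputable def theta (γ : Gamma) : ℕ := sInf {m | proj m = γ}

/-- Essential numbers: the numbers `θ(γ)`, `γ ∈ Γ(ℚ/ℤ)`. -/
def IsEssential (n : ℕ) : Prop := ∃ γ : Gamma, IsTheta γ n

/-- `F`-primes: the numbers `θ(g)`, `g` a generator of `Γ(ℚ/ℤ)`. -/
def IsFPrime (n : ℕ) : Prop := ∃ g : QZ, IsTheta (FreeMonoid.of g) n

/-- The `*`-multiplication of essential numbers, transported from `Γ(ℚ/ℤ)` by the bijection
`θ`, whose inverse is `π` (only its values at essential numbers are meaningful). -/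
noncomputable def essMul (n₁ n₂ : ℕ) : ℕ := theta (proj n₁ * proj n₂)

/-- The product `n₁ * ⋯ * n_k` of a list of essential numbers; the unit is `θ(1) = 0`. -/
noncomputable def essProd (l : List ℕ) : ℕ := l.foldl essMul 0

/-- The power `n^{*r}`. -/
noncomputable def essPow (n r : ℕ) : ℕ := essProd (List.replicate r n)

/-- The `Σ`-orbit of a word `g₁ * ⋯ * g_s`: all words `g_{ϖ(1)} * ⋯ * g_{ϖ(s)}`, with `ϖ` a
permutation of the `s` positions. -/
def orbit (γ : Gamma) : Set Gamma :=
  {γ' | ∃ ϖ : Equiv.Perm (Fin γ.toList.length),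
    γ' = FreeMonoid.ofList (List.ofFn fun i => γ.toList.get (ϖ i))}

/-- Commutative essential numbers: the lowest numbers in the fibres of the map
`π_Σ : n ↦ (Σ-orbit of π(n))` over the orbits of `Σ` on `Γ(ℚ/ℤ)`. -/
def IsCommEssential (n : ℕ) : Prop :=
  ∃ γ : Gamma, IsLeast {m | orbit (proj m) = orbit γ} n

/-- The set `𝒜₁` of vectors `(α₁, …, α_q)`, `q ≥ 1`, with `α₁ ≥ 1` and
`α₂, …, α_q ≥ 2`. -/
def A₁ : Set (List ℕ) := {A | ∃ a l, A = a :: l ∧ 1 ≤ a ∧ ∀ b ∈ l, 2 ≤ b}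

/-- `c(g) = A`: the vector `A` is the (unique) element of `𝒜₁` with `g = ⟨A⟩`. -/
def IsExpansion (g : ℚ) (A : List ℕ) : Prop := A ∈ A₁ ∧ cf A = g

/-- The `m`-th coordinate of `x` counted from the right, starting with `m = 0`, where `x` is
continued to the left by coordinates equal to `∞`. -/
def coord (x : List ℕ) (m : ℕ) : ℕ∞ := (x.reverse[m]?).elim ⊤ fun a => (a : ℕ∞)

/-- `x ◁ y` for vectors: at the rightmost position where they differ, the coordinate of `x`
is smaller. -/
def VecLT (x y : List ℕ) : Prop :=
  ∃ r, (∀ m < r, coord x m = coord y m) ∧ coord x r < coord y r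

/-- `n₁ ◁ n₂` for `F`-primes `n₁ = θ(g₁)`, `n₂ = θ(g₂)`: it means `c(g₁) ◁ c(g₂)`. -/
def PrimeLT (n₁ n₂ : ℕ) : Prop :=
  ∃ g₁ g₂ : QZ, IsTheta (FreeMonoid.of g₁) n₁ ∧ IsTheta (FreeMonoid.of g₂) n₂ ∧
    ∃ x y : List ℕ, IsExpansion g₁ x ∧ IsExpansion g₂ y ∧ VecLT x y

end FibPart

namespace FibPart

/-! Encode a number by the gaps between its successive Fibonacci indices. Inside a simple component
the gaps are even, `2 * (b - 1)`; a component opens with an odd gap `2 * (a - 1) + 1`. So the gap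
list determines the multivector and conversely, up to the parity `e` of the offset before the first
index.

The least number over a word `w` is `num w`, obtained with offset 0 by concatenating the gaps of the
expansions of the letters (`proj_num`, `num_le`). Any other number over `w` has a larger top index:
its offset is 1, or its first component represents an integer, or a number above 1, modulo the
integers.

Permuting the letters permutes the gaps, so the top index is unchanged. For equal sums, a larger gap
at the last difference means a smaller next index, hence a smaller number (`val_lt_val`). The order
`◁` is this comparison of gaps from the right, the padding by `∞` matching the extra 1 in the
opening gap (`VecLT.exists_gaps`). Thus exchanging an adjacent descent lowers the number
(`num_swap_lt`), and a minimal arrangement is sorted. An orbit contains one sorted word only, so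
sorted words are exactly the minimal ones; grouping equal letters gives the powers. -/

/-- The partial sums `j + g₁, j + g₁ + g₂, …` of a list of gaps, starting from `j`. -/
def idx : ℕ → List ℕ → List ℕ
  | _, [] => []
  | j, g :: G => (j + g) :: idx (j + g) G

/-- The gaps between the indices of a simple component with associated vector `A`, the first one
counted from the last index of the preceding component. -/
def gaps : List ℕ → List ℕ
  | [] => []
  | a :: l => (2 * (a - 1) + 1) :: l.map fun b => 2 * (b - 1)

/-- The number whose Fibonacci indices are the partial sums of the gaps `G`, starting from `j`. -/
def val (j : ℕ) (G : List ℕ) : ℕ := ((idx j G).map f).sum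

/-! ### Gap lists and the comparison of their numbers. -/

theorem idx_append (j : ℕ) (G H : List ℕ) : idx j (G ++ H) = idx j G ++ idx (j + G.sum) H := by
  induction G generalizing j with
  | nil => simp [idx]
  | cons g G ih => simp [idx, ih, add_assoc]

theorem length_idx (j : ℕ) (G : List ℕ) : (idx j G).length = G.length := by
  induction G generalizing j with
  | nil => rfl
  | cons g G ih => simp [idx, ih]

theorem length_gaps (A : List ℕ) : (gaps A).length = A.length := by
  cases A <;> simp [gaps]

theorem gaps_ne_nil {A : List ℕ} (h : A ≠ []) : gaps A ≠ [] := by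
  cases A <;> simp_all [gaps]

theorem val_append (j : ℕ) (G H : List ℕ) : val j (G ++ H) = val j G + val (j + G.sum) H := by
  simp [val, idx_append]

theorem val_singleton (j g : ℕ) : val j [g] = f (j + g) := by simp [val, idx]

theorem f_mono : Monotone f := fun a b h => Nat.fib_mono (by omega)

theorem f_add_two (n : ℕ) : f (n + 2) = f n + f (n + 1) := Nat.fib_add_two

/-- Lists of gaps of Fibonacci representations: the gaps are at least two, the first one at least
one. -/
def ValidGaps (G : List ℕ) : Prop := (∀ g ∈ G, 1 ≤ g) ∧ ∀ g ∈ G.tail, 2 ≤ g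

/-- A number is smaller than the Fibonacci number following its largest Fibonacci summand. -/
theorem val_zero_lt {G : List ℕ} (h : ValidGaps G) : val 0 G < f (G.sum + 1) := by
  induction G using List.reverseRecOn with
  | nil => simp [val, idx, f]
  | append_singleton G g ih =>
    cases G with
    | nil =>
      have hg : 1 ≤ g := h.1 g (by simp)
      simpa [val_singleton, f] using Nat.fib_lt_fib_succ (n := g + 1) (by omega)
    | cons a G =>
      have hg : 2 ≤ g := h.2 g (by simp)
      have hG := ih ⟨fun x hx => h.1 x (by simp at hx ⊢; tauto),
        fun x hx => h.2 x (by simp at hx ⊢; tauto)⟩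
      rw [val_append, val_singleton]
      -- With last gap `2 + k`, the earlier summands total less than `f (G.sum + 1) ≤ f (G.sum + k +
      -- 1)`, which together with the top summand makes up the next Fibonacci number.
      obtain ⟨k, rfl⟩ := Nat.exists_eq_add_of_le hg
      generalize a :: G = G at *
      have h3 : f (G.sum + 1) ≤ f (G.sum + k + 1) := f_mono (by omega)
      have e1 : 0 + G.sum + (2 + k) = G.sum + k + 2 := by omega
      have e2 : (G ++ [2 + k]).sum + 1 = G.sum + k + 1 + 2 := by simp; omega
      rw [e1, e2, f_add_two (_ + 1)]
      rw [show G.sum + k + 1 + 1 = G.sum + k + 2 by omega]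
      omega

theorem le_val {G : List ℕ} (j : ℕ) (h : G ≠ []) : f (j + G.sum) ≤ val j G := by
  obtain ⟨G, g, rfl⟩ := List.eq_nil_or_concat G |>.resolve_left h
  rw [List.concat_eq_append, val_append, val_singleton]
  simp [add_assoc]

theorem ValidGaps.append_left {G H : List ℕ} (h : ValidGaps (G ++ H)) : ValidGaps G := by
  refine ⟨fun g hg => h.1 g (by simp [hg]), fun g hg => h.2 g ?_⟩
  cases G <;> simp_all

/-- Of two lists of gaps with equal sums, the one with the larger gap at the last position where
they differ gives the smaller number. -/
theorem val_lt_val {P P' S : List ℕ} {g g' : ℕ} (hP : ValidGaps P)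
    (hs : (P ++ [g] ++ S).sum = (P' ++ [g'] ++ S).sum) (hg : g' < g) :
    val 0 (P ++ [g] ++ S) < val 0 (P' ++ [g'] ++ S) := by
  simp only [List.sum_append, List.sum_singleton] at hs
  have hlt : P.sum < P'.sum := by omega
  have hne : P' ≠ [] := by rintro rfl; simp at hlt
  simp only [val_append, val_singleton, List.sum_append, List.sum_singleton, zero_add]
  rw [show P.sum + g = P'.sum + g' by omega]
  have h1 := val_zero_lt hP
  have h2 := le_val 0 hne
  have h3 : f (P.sum + 1) ≤ f (0 + P'.sum) := f_mono (by omega)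
  omega

/-! ### Zeckendorf indices and gap lists. -/

/-- The Fibonacci indices of a number are the unique ones with these properties. -/
theorem Z_sum {I : List ℕ} (h1 : ∀ a ∈ I, 1 ≤ a) (h2 : I.IsChain fun a b => a + 2 ≤ b) :
    Z (I.map f).sum = I := by
  -- Mathlib's condition is a chain ending in an appended 0, which forces the smallest shifted index
  -- to be at least 2.
  have hr : (I.map (· + 1)).reverse.IsZeckendorfRep := by
    unfold List.IsZeckendorfRep
    rw [List.isChain_append]
    refine ⟨?_, by simp, ?_⟩
    · rw [List.isChain_reverse, List.isChain_map]
      exact h2.imp fun a b h => by omega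
    · intro x hx y hy
      have hx := List.mem_of_mem_getLast? hx
      simp only [List.mem_reverse, List.mem_map] at hx
      obtain ⟨a, ha, rfl⟩ := hx
      have := h1 a ha
      simp at hy
      omega
  have := Nat.zeckendorf_sum_fib hr
  rw [List.map_reverse, List.sum_reverse, List.map_map] at this
  rw [Z, show I.map f = I.map (Nat.fib ∘ (· + 1)) from rfl, this, List.map_reverse, List.map_map,
    List.reverse_reverse]
  simp [Function.comp_def]

theorem Z_spec (n : ℕ) : (∀ a ∈ Z n, 1 ≤ a) ∧ (Z n).IsChain fun a b => a + 2 ≤ b := by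
  have hz := Nat.isZeckendorfRep_zeckendorf n
  unfold List.IsZeckendorfRep at hz
  have htr : IsTrans ℕ (fun a b => b + 2 ≤ a) := ⟨fun a b c h1 h2 => by omega⟩
  have hp := List.isChain_iff_pairwise.1 hz
  rw [List.pairwise_append] at hp
  have key : ∀ a ∈ n.zeckendorf, 2 ≤ a := fun a ha => by
    have := hp.2.2 a ha 0 (by simp)
    omega
  constructor
  · intro a ha
    simp only [Z, List.mem_reverse, List.mem_map] at ha
    obtain ⟨b, hb, rfl⟩ := ha
    have := key b hb
    omega
  · rw [Z, List.isChain_reverse, List.isChain_map]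
    refine (List.Pairwise.imp_of_mem ?_ hp.1).isChain
    intro a b ha hb h
    have := key a ha
    have := key b hb
    omega

theorem isChain_idx (G : List ℕ) (j : ℕ) (h : ∀ g ∈ G, 2 ≤ g) :
    (j :: idx j G).IsChain fun a b => a + 2 ≤ b := by
  induction G generalizing j with
  | nil => simp [idx]
  | cons g G ih =>
    simp only [idx, List.isChain_cons_cons]
    exact ⟨by have := h g (by simp); omega, ih _ fun x hx => h x (by simp [hx])⟩

theorem le_of_mem_idx {G : List ℕ} {j a : ℕ} (h : ∀ g ∈ G, 1 ≤ g) (ha : a ∈ idx j G) :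
    j + 1 ≤ a := by
  induction G generalizing j with
  | nil => simp [idx] at ha
  | cons g G ih =>
    have := h g (by simp)
    rcases List.mem_cons.1 ha with rfl | ha
    · omega
    · have := ih (fun x hx => h x (by simp [hx])) ha
      omega

theorem Z_val {G : List ℕ} (h : ValidGaps G) : Z (val 0 G) = idx 0 G := by
  apply Z_sum
  · intro a ha
    have := le_of_mem_idx h.1 ha
    omega
  · cases G with
    | nil => simp [idx]
    | cons g G => exact isChain_idx G _ h.2

/-- The multivectors whose components are nonempty and have all entries at least two. -/
def ValidMulti (M : List (List ℕ)) : Prop := ∀ A ∈ M, A ≠ [] ∧ ∀ a ∈ A, 2 ≤ a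

/-- Here `l` is the rest of the component containing `j`, and `M` lists the later components. An
even gap extends the current component; an odd one closes it and opens a new one. -/
theorem exists_eq_idx (I : List ℕ) (j : ℕ) (h : (j :: I).IsChain fun a b => a + 2 ≤ b) :
    ∃ (l : List ℕ) (M : List (List ℕ)), (∀ a ∈ l, 2 ≤ a) ∧ ValidMulti M ∧
      I = idx j ((l.map fun b => 2 * (b - 1)) ++ M.flatMap gaps) := by
  induction I generalizing j with
  | nil => exact ⟨[], [], by simp, by simp [ValidMulti], by simp [idx]⟩
  | cons i I ih =>
    rw [List.isChain_cons_cons] at h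
    obtain ⟨l, M, hl, hM, hI⟩ := ih i h.2
    rcases Nat.even_or_odd' (i - j) with ⟨k, hk | hk⟩
    · refine ⟨(k + 1) :: l, M, ?_, hM, ?_⟩
      · intro a ha
        rcases List.mem_cons.1 ha with rfl | ha
        · omega
        · exact hl a ha
      · rw [hI]
        simp only [List.map_cons, List.cons_append, idx]
        rw [show j + 2 * (k + 1 - 1) = i by omega]
    · refine ⟨[], ((k + 1) :: l) :: M, by simp, ?_, ?_⟩
      · intro A hA
        rcases List.mem_cons.1 hA with rfl | hA
        · refine ⟨by simp, fun a ha => ?_⟩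
          rcases List.mem_cons.1 ha with rfl | ha
          · omega
          · exact hl a ha
        · exact hM A hA
      · rw [hI]
        simp only [List.map_nil, List.nil_append, List.flatMap_cons, gaps, List.cons_append, idx]
        rw [show j + (2 * (k + 1 - 1) + 1) = i by omega]

/-- Every number is determined by its multivector and the parity of its first Fibonacci index. -/
theorem exists_Z_eq_idx (n : ℕ) : n = 0 ∨ ∃ (e : ℕ) (A : List ℕ) (M : List (List ℕ)), e < 2 ∧
    A ∈ A₁ ∧ ValidMulti M ∧ Z n = idx e ((A :: M).flatMap gaps) := by
  obtain ⟨h1, h2⟩ := Z_spec n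
  cases hI : Z n with
  | nil =>
    left
    rw [← sum_Z n, hI]
    rfl
  | cons i I =>
    right
    rw [hI] at h1 h2
    obtain ⟨l, M, hl, hM, hI⟩ := exists_eq_idx I i h2
    refine ⟨(i - 1) % 2, ((i - 1) / 2 + 1) :: l, M, by omega, ⟨_, _, rfl, by omega, hl⟩, hM, ?_⟩
    have := h1 i (by simp)
    rw [hI]
    simp only [List.flatMap_cons, gaps, List.cons_append, idx]
    rw [show (i - 1) % 2 + (2 * ((i - 1) / 2 + 1 - 1) + 1) = i by omega]

/-! ### Recovering the multivector from the gaps. -/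

theorem assocAux_idx (G : List ℕ) (j : ℕ) : assocAux j (idx j G) = G.map fun g => g / 2 + 1 := by
  induction G generalizing j with
  | nil => rfl
  | cons g G ih => simp [idx, assocAux, ih]

theorem map_gaps {A : List ℕ} (h : ∀ a ∈ A, 1 ≤ a) : (gaps A).map (fun g => g / 2 + 1) = A := by
  cases A with
  | nil => rfl
  | cons a l =>
    simp only [gaps, List.map_cons, List.map_map]
    have := h a (by simp)
    congr 1
    · omega
    · conv_rhs => rw [← List.map_id l]
      refine List.map_congr_left fun b hb => ?_
      have := h b (by simp [hb])
      simp
      omega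

theorem map_flatMap_gaps {M : List (List ℕ)} (h : ∀ A ∈ M, ∀ a ∈ A, 1 ≤ a) :
    (M.flatMap gaps).map (fun g => g / 2 + 1) = M.flatten := by
  induction M with
  | nil => rfl
  | cons A M ih =>
    rw [List.flatMap_cons, List.map_append, map_gaps (h A (by simp)),
      ih fun B hB => h B (by simp [hB]), List.flatten_cons]

/-- Halving forgets the parity of a gap. The first entry is computed from base 1 rather than `e`,
which is harmless because the first gap is odd and `e < 2`. -/
theorem assocVector_idx {e : ℕ} {M : List (List ℕ)} (he : e < 2)
    (h : ∀ A ∈ M, A ≠ [] ∧ ∀ a ∈ A, 1 ≤ a) :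
    assocVector (idx e (M.flatMap gaps)) = M.flatten := by
  rw [← map_flatMap_gaps fun A hA => (h A hA).2]
  rcases M with - | ⟨- | ⟨a, l⟩, M⟩
  · rfl
  · simp at h
  · simp only [List.flatMap_cons, gaps, List.cons_append, idx, assocVector, assocAux, assocAux_idx,
      List.map_cons]
    congr 1
    omega

theorem isChain_parity_idx (l : List ℕ) (j : ℕ) :
    (j :: idx j (l.map fun b => 2 * (b - 1))).IsChain fun a b => (a % 2 == b % 2) = true := by
  induction l generalizing j with
  | nil => simp [idx]
  | cons g G ih =>
    simp only [List.map_cons, idx, List.isChain_cons_cons]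
    exact ⟨by simp, ih _⟩

theorem getLast?_idx {G : List ℕ} (j : ℕ) (h : G ≠ []) : (idx j G).getLast? = some (j + G.sum) := by
  obtain ⟨G, g, rfl⟩ := List.eq_nil_or_concat G |>.resolve_left h
  simp [List.concat_eq_append, idx_append, idx, add_assoc]

/-- Only the opening gap of a component is odd, so parity changes exactly at the boundaries between
components. -/
theorem map_length_canonicalForm_idx (M : List (List ℕ)) (e : ℕ) (h : ∀ A ∈ M, A ≠ []) :
    (canonicalForm (idx e (M.flatMap gaps))).map List.length = M.map List.length := by
  induction M generalizing e with
  | nil => rfl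
  | cons A M ih =>
    have hA := h A (by simp)
    rw [List.flatMap_cons, idx_append, canonicalForm, List.splitBy_append, List.splitBy_of_isChain,
      List.map_append]
    · have := ih (e + (gaps A).sum) fun B hB => h B (by simp [hB])
      rw [canonicalForm] at this
      rw [this]
      simp [length_idx, length_gaps]
    · rw [← List.length_pos_iff, length_idx, List.length_pos_iff]
      exact gaps_ne_nil hA
    · obtain ⟨a, l, rfl⟩ := List.exists_cons_of_ne_nil hA
      exact isChain_parity_idx l _
    · rw [getLast?_idx _ (gaps_ne_nil hA)]
      rcases M with - | ⟨- | ⟨a, l⟩, M⟩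
      · simp [idx]
      · simp at h
      · simp only [List.flatMap_cons, gaps, List.cons_append, idx, List.head?_cons,
          Option.mem_some_iff]
        rintro x rfl y rfl
        simp only [beq_eq_false_iff_ne]
        omega

theorem splitLengths_flatten {α : Type*} (M : List (List α)) :
    (M.map List.length).splitLengths M.flatten = M := by
  induction M with
  | nil => rfl
  | cons A M ih => simp [ih]

theorem multivector_idx {e : ℕ} {M : List (List ℕ)} (he : e < 2)
    (h : ∀ A ∈ M, A ≠ [] ∧ ∀ a ∈ A, 1 ≤ a) : multivector (idx e (M.flatMap gaps)) = M := by
  rw [multivector, map_length_canonicalForm_idx M e fun A hA => (h A hA).1, assocVector_idx he h,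
    splitLengths_flatten]

/-! ### Continued fractions and letters. -/

theorem cf_mem_Ico {l : List ℕ} (h : ∀ a ∈ l, 2 ≤ a) : 0 ≤ cf l ∧ cf l < 1 := by
  induction l with
  | nil => simp [cf]
  | cons a l ih =>
    have ⟨h0, h1⟩ := ih fun x hx => h x (by simp [hx])
    have ha : (2 : ℚ) ≤ a := by exact_mod_cast h a (by simp)
    rw [cf]
    constructor
    · apply div_nonneg <;> linarith
    · rw [div_lt_one] <;> linarith

theorem cf_pos {l : List ℕ} (h : ∀ a ∈ l, 2 ≤ a) (hl : l ≠ []) : 0 < cf l := by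
  obtain ⟨a, l, rfl⟩ := List.exists_cons_of_ne_nil hl
  have := cf_mem_Ico fun x hx => h x (List.mem_cons_of_mem a hx)
  have ha : (2 : ℚ) ≤ a := by exact_mod_cast h a (by simp)
  rw [cf]
  apply one_div_pos.2
  linarith

/-- The reciprocal `a - cf l` lies in `(a - 1, a]`, so it determines `a`, and then `cf l`. -/
theorem cf_injOn {l m : List ℕ} (hl : ∀ a ∈ l, 2 ≤ a) (hm : ∀ a ∈ m, 2 ≤ a)
    (h : cf l = cf m) : l = m := by
  induction l generalizing m with
  | nil =>
    by_contra hne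
    have := cf_pos hm (Ne.symm hne)
    rw [← h] at this
    simp [cf] at this
  | cons a l ih =>
    cases m with
    | nil =>
      have := cf_pos hl (by simp)
      rw [h] at this
      simp [cf] at this
    | cons b m =>
      have hl' : ∀ a ∈ l, 2 ≤ a := fun x hx => hl x (by simp [hx])
      have hm' : ∀ a ∈ m, 2 ≤ a := fun x hx => hm x (by simp [hx])
      have h1 := cf_mem_Ico hl'
      have h2 := cf_mem_Ico hm'
      simp only [cf, one_div, inv_inj] at h
      have hab : a = b := by
        have h3 : (a : ℚ) < b + 1 := by linarith
        have h4 : (b : ℚ) < a + 1 := by linarith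
        have h3' : a < b + 1 := by exact_mod_cast h3
        have h4' : b < a + 1 := by exact_mod_cast h4
        omega
      subst hab
      rw [ih hl' hm' (by linarith)]

/-- Euclid's algorithm with division rounded up: `q / p = a - (a * p - q) / p`, where `0 ≤ a * p - q
< p`. -/
theorem exists_cf_eq (q p : ℕ) (h : p < q) : ∃ l : List ℕ, (∀ a ∈ l, 2 ≤ a) ∧ cf l = p / q := by
  induction q using Nat.strong_induction_on generalizing p with
  | _ q ih =>
    rcases Nat.eq_zero_or_pos p with rfl | hp
    · exact ⟨[], by simp, by simp [cf]⟩
    · set a := (q + p - 1) / p with ha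
      have h1 : q ≤ a * p := by
        have := Nat.div_add_mod (q + p - 1) p
        have := Nat.mod_lt (q + p - 1) hp
        rw [mul_comm]
        rw [← ha] at *
        omega
      have h2 : a * p < q + p := by
        have := Nat.div_mul_le_self (q + p - 1) p
        rw [← ha] at this
        omega
      obtain ⟨l, hl, hc⟩ := ih p h (a * p - q) (by omega)
      refine ⟨a :: l, ?_, ?_⟩
      · intro x hx
        rcases List.mem_cons.1 hx with rfl | hx
        · rw [ha, Nat.le_div_iff_mul_le hp]
          omega
        · exact hl x hx
      · have hp' : (p : ℚ) ≠ 0 := by exact_mod_cast hp.ne'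
        have hq' : (q : ℚ) ≠ 0 := by exact_mod_cast (by omega : q ≠ 0)
        rw [cf, hc, Nat.cast_sub h1, Nat.cast_mul]
        rw [show (a : ℚ) - (a * p - q) / p = q / p by field_simp; ring]
        simp

/-- The expansion `c(g)` of `g ∈ (0,1)` as a continued fraction with entries at least two. -/
theorem exists_expansion (g : QZ) : ∃ l : List ℕ, l ≠ [] ∧ (∀ a ∈ l, 2 ≤ a) ∧ cf l = g.1 := by
  obtain ⟨g, h0, h1⟩ := g
  have hn : 0 < g.num := Rat.num_pos.2 h0
  have hd : (g.num.toNat : ℚ) / g.den = g := by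
    conv_rhs => rw [← Rat.num_div_den g]
    congr 1
    exact_mod_cast Int.toNat_of_nonneg hn.le
  obtain ⟨l, hl, hc⟩ := exists_cf_eq g.den g.num.toNat (by
    rw [← hd, div_lt_one (by exact_mod_cast g.den_pos)] at h1
    exact_mod_cast h1)
  rw [hd] at hc
  exact ⟨l, by rintro rfl; rw [← hc] at h0; simp [cf] at h0, hl, hc⟩

/-- The expansion `c(g)`. -/
noncomputable def expansion (g : QZ) : List ℕ := (exists_expansion g).choose

theorem expansion_ne_nil (g : QZ) : expansion g ≠ [] := (exists_expansion g).choose_spec.1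

theorem two_le_of_mem_expansion (g : QZ) : ∀ a ∈ expansion g, 2 ≤ a :=
  (exists_expansion g).choose_spec.2.1

theorem cf_expansion (g : QZ) : cf (expansion g) = g.1 := (exists_expansion g).choose_spec.2.2

theorem eq_expansion {g : QZ} {l : List ℕ} (hl : ∀ a ∈ l, 2 ≤ a) (h : cf l = g.1) :
    l = expansion g :=
  cf_injOn hl (two_le_of_mem_expansion g) (h.trans (cf_expansion g).symm)

theorem expansion_injective : Function.Injective expansion := fun g h e =>
  Subtype.ext (by rw [← cf_expansion, e, cf_expansion])

theorem isExpansion_iff {g : QZ} {A : List ℕ} : IsExpansion g.1 A ↔ A = expansion g := by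
  constructor
  · rintro ⟨⟨a, l, rfl, ha, hl⟩, hc⟩
    refine eq_expansion (fun x hx => ?_) hc
    rcases List.mem_cons.1 hx with rfl | hx
    -- A leading 1 would make the value `1 / (1 - cf l)` at least 1.
    · by_contra hlt
      obtain rfl : x = 1 := by omega
      have ⟨h0, h1⟩ := cf_mem_Ico hl
      have h2 := g.2.2
      rw [← hc, cf, div_lt_one (by push_cast; linarith)] at h2
      push_cast at h2
      linarith
    · exact hl x hx
  · rintro rfl
    refine ⟨?_, cf_expansion g⟩
    obtain ⟨a, l, h⟩ := List.exists_cons_of_ne_nil (expansion_ne_nil g)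
    have h2 := two_le_of_mem_expansion g
    rw [h] at h2
    exact ⟨a, l, h, by have := h2 a (by simp); omega, fun b hb => h2 b (by simp [hb])⟩

theorem letter_coe (g : QZ) : letter g.1 = FreeMonoid.of g := by
  have h : Int.fract g.1 = g.1 := Int.fract_eq_self.2 ⟨g.2.1.le, g.2.2⟩
  have h' : ¬Int.fract g.1 = 0 := by rw [h]; exact g.2.1.ne'
  rw [letter, dif_neg h']
  congr 1
  exact Subtype.ext h

theorem letter_one_add (x : ℚ) : letter (1 + x) = letter x := by
  simp [letter, Int.fract_one_add]

theorem exists_eq_expansion {A : List ℕ} (h : A ≠ []) (h2 : ∀ a ∈ A, 2 ≤ a) :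
    ∃ g, A = expansion g :=
  ⟨⟨cf A, cf_pos h2 h, (cf_mem_Ico h2).2⟩, eq_expansion h2 rfl⟩

theorem letter_expansion (g : QZ) : letter (cf (expansion g)) = FreeMonoid.of g := by
  rw [cf_expansion, letter_coe]

/-- Expansions of rationals that are not less than one only increase the sum of the gaps. -/
theorem letter_cf_of_mem {A : List ℕ} (hA : A ∈ A₁) : letter (cf A) = 1 ∨
    ∃ g, letter (cf A) = FreeMonoid.of g ∧
      (A = expansion g ∨ (gaps (expansion g)).sum < (gaps A).sum) := by
  obtain ⟨a, l, rfl, ha, hl⟩ := hA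
  induction l generalizing a with
  | nil =>
    rcases ha.eq_or_lt with rfl | ha
    · left
      simp [cf, letter]
    · right
      obtain ⟨g, hg⟩ := exists_eq_expansion (A := [a]) (by simp) (by simpa using Nat.succ_le_of_lt ha)
      exact ⟨g, by rw [hg, letter_expansion], Or.inl hg⟩
  | cons b l ih =>
    rcases ha.eq_or_lt with rfl | ha
    · have hb : 2 ≤ b := hl b (by simp)
      have hl' : ∀ x ∈ l, 2 ≤ x := fun x hx => hl x (by simp [hx])
      have ⟨h0, h1⟩ := cf_mem_Ico hl'
      have hb' : (2 : ℚ) ≤ b := by exact_mod_cast hb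
      -- A leading 1 is absorbed by an integer shift, which lowers the gap sum by 2. The new head
      -- may again be 1, hence the induction over all heads.
      have hcf : cf (1 :: b :: l) = 1 + cf ((b - 1) :: l) := by
        have e1 : (b : ℚ) - cf l ≠ 0 := by linarith
        have e2 : (b : ℚ) - 1 - cf l ≠ 0 := by linarith
        have e3 : (b : ℚ) - cf l - 1 ≠ 0 := by linarith
        simp only [cf]
        rw [Nat.cast_sub (by omega), Nat.cast_one]
        field_simp
        ring
      have hsum : (gaps (1 :: b :: l)).sum = (gaps ((b - 1) :: l)).sum + 2 := by
        simp only [gaps, List.map_cons, List.sum_cons]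
        omega
      rw [hcf, letter_one_add, hsum]
      rcases ih (b - 1) (by omega) hl' with h | ⟨g, hg, h⟩
      · exact Or.inl h
      · refine Or.inr ⟨g, hg, Or.inr ?_⟩
        rcases h with h | h
        · rw [h]
          omega
        · omega
    · right
      obtain ⟨g, hg⟩ := exists_eq_expansion (A := a :: b :: l) (by simp) (by
        intro x hx
        rcases List.mem_cons.1 hx with rfl | hx
        · exact ha
        · exact hl x hx)
      exact ⟨g, by rw [hg, letter_expansion], Or.inl hg⟩

/-! ### The explicit form of `θ`. -/

/-- The gaps between the Fibonacci indices of `θ` of a word. -/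
noncomputable def wordGaps (w : List QZ) : List ℕ := (w.map expansion).flatMap gaps

/-- The number `θ` of a word, given explicitly by its Fibonacci indices. -/
noncomputable def num (w : List QZ) : ℕ := val 0 (wordGaps w)

theorem wordGaps_append (v w : List QZ) : wordGaps (v ++ w) = wordGaps v ++ wordGaps w := by
  simp [wordGaps]

theorem wordGaps_singleton (g : QZ) : wordGaps [g] = gaps (expansion g) := by
  simp [wordGaps]

theorem two_le_of_mem_map_sub {l : List ℕ} (hl : ∀ a ∈ l, 2 ≤ a) :
    ∀ g ∈ l.map fun b => 2 * (b - 1), 2 ≤ g := by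
  intro g hg
  obtain ⟨b, hb, rfl⟩ := List.mem_map.1 hg
  have := hl b hb
  omega

theorem two_le_of_mem_gaps {A : List ℕ} (hA : ∀ a ∈ A, 2 ≤ a) : ∀ g ∈ gaps A, 2 ≤ g := by
  cases A with
  | nil => simp [gaps]
  | cons a l =>
    intro g hg
    rcases List.mem_cons.1 hg with rfl | hg
    · have := hA a (by simp)
      omega
    · exact two_le_of_mem_map_sub (fun x hx => hA x (by simp [hx])) g hg

theorem validGaps_wordGaps (w : List QZ) : ValidGaps (wordGaps w) := by
  have h : ∀ g ∈ wordGaps w, 2 ≤ g := by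
    intro g hg
    simp only [wordGaps, List.mem_flatMap, List.mem_map] at hg
    obtain ⟨_, ⟨x, -, rfl⟩, hg⟩ := hg
    exact two_le_of_mem_gaps (two_le_of_mem_expansion x) g hg
  exact ⟨fun g hg => by have := h g hg; omega, fun g hg => h g (List.mem_of_mem_tail hg)⟩

theorem p_map_expansion (w : List QZ) : p (w.map expansion) = FreeMonoid.ofList w := by
  induction w with
  | nil => rfl
  | cons g w ih =>
    rw [p, List.map_cons, List.map_cons, List.prod_cons, letter_expansion, ← p, ih,
      FreeMonoid.ofList_cons]

theorem proj_num (w : List QZ) : proj (num w) = FreeMonoid.ofList w := by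
  rw [proj, num, Z_val (validGaps_wordGaps w), wordGaps, multivector_idx (by omega),
    p_map_expansion]
  intro A hA
  obtain ⟨g, -, rfl⟩ := List.mem_map.1 hA
  exact ⟨expansion_ne_nil g, fun a ha => by have := two_le_of_mem_expansion g a ha; omega⟩

theorem ValidMulti.exists_eq_map {M : List (List ℕ)} (h : ValidMulti M) :
    ∃ w : List QZ, M = w.map expansion := by
  induction M with
  | nil => exact ⟨[], rfl⟩
  | cons A M ih =>
    obtain ⟨w, rfl⟩ := ih fun B hB => h B (by simp [hB])
    obtain ⟨g, rfl⟩ := exists_eq_expansion (h A (by simp)).1 (h A (by simp)).2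
    exact ⟨g :: w, rfl⟩

/-- `num w` lies below the Fibonacci number after its top one, and `n` is at least its own top
Fibonacci summand. -/
theorem num_lt {w : List QZ} {n e : ℕ} {G : List ℕ} (hZ : Z n = idx e G) (hG : G ≠ [])
    (h : (wordGaps w).sum < e + G.sum) : num w < n := by
  have hn : n = val e G := by rw [val, ← hZ, sum_Z]
  calc num w < f ((wordGaps w).sum + 1) := val_zero_lt (validGaps_wordGaps w)
    _ ≤ f (e + G.sum) := f_mono h
    _ ≤ n := hn ▸ le_val e hG

theorem num_le {w : List QZ} {n : ℕ} (h : proj n = FreeMonoid.ofList w) : num w ≤ n := by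
  rcases exists_Z_eq_idx n with rfl | ⟨e, A, M, he, hA, hM, hZ⟩
  · have : FreeMonoid.ofList w = 1 := by
      rw [← h]
      simp [proj, p, Z, multivector, canonicalForm, assocVector, assocAux]
    obtain rfl : w = [] := this
    rfl
  · have hA' := hA
    obtain ⟨a, l, rfl, ha, hl⟩ := hA'
    have hne : (((a :: l) :: M).flatMap gaps) ≠ [] := by simp [gaps]
    obtain ⟨v, rfl⟩ := hM.exists_eq_map
    rw [proj, hZ, multivector_idx he, p, List.map_cons, List.prod_cons, ← p, p_map_expansion] at h
    · have hsum : (((a :: l) :: v.map expansion).flatMap gaps).sum =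
          (gaps (a :: l)).sum + (wordGaps v).sum := by
        simp [wordGaps]
      -- Equality is possible only when the first component is already an expansion and `e = 0`;
      -- otherwise the top index of `n` is larger.
      rcases letter_cf_of_mem hA with h1 | ⟨g, hg, hc⟩
      · rw [h1, one_mul] at h
        obtain rfl : v = w := h
        refine (num_lt hZ hne ?_).le
        rw [hsum]
        simp only [gaps, List.sum_cons]
        omega
      · rw [hg, ← FreeMonoid.ofList_cons] at h
        obtain rfl : g :: v = w := h
        have hw : (wordGaps (g :: v)).sum = (gaps (expansion g)).sum + (wordGaps v).sum := by
          simp [wordGaps]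
        rcases hc with hc | hc
        · rcases Nat.eq_zero_or_pos e with rfl | he
          · rw [hc] at hZ
            apply le_of_eq
            rw [← sum_Z n, hZ]
            rfl
          · refine (num_lt hZ hne ?_).le
            rw [hsum, hw, hc]
            omega
        · refine (num_lt hZ hne ?_).le
          rw [hsum, hw]
          omega
    · intro B hB
      rcases List.mem_cons.1 hB with rfl | hB
      · refine ⟨by simp, fun x hx => ?_⟩
        rcases List.mem_cons.1 hx with rfl | hx
        · exact ha
        · have := hl x hx
          omega
      · exact ⟨(hM B hB).1, fun x hx => by have := (hM B hB).2 x hx; omega⟩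

theorem isTheta_iff {γ : Gamma} {n : ℕ} : IsTheta γ n ↔ n = num γ.toList := by
  have h : IsTheta γ (num γ.toList) := ⟨proj_num _, fun m hm => num_le hm⟩
  exact ⟨fun hn => hn.unique h, fun hn => hn ▸ h⟩

theorem theta_eq (γ : Gamma) : theta γ = num γ.toList :=
  ((isTheta_iff (γ := γ)).2 rfl).csInf_eq

/-! ### The order `◁` and adjacent exchanges. -/

/-- The position of `g` with respect to the order `◁` on expansions. -/
noncomputable def key (g : QZ) : Lex (ℕ → ℕ∞) := toLex (coord (expansion g))

theorem key_lt_key {g h : QZ} : key g < key h ↔ VecLT (expansion g) (expansion h) := Iff.rfl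

theorem coord_injective : Function.Injective coord := by
  intro x y h
  rw [← List.reverse_inj]
  refine List.ext_getElem? fun m => ?_
  have := congrFun h m
  unfold coord at this
  cases hx : x.reverse[m]? <;> cases hy : y.reverse[m]? <;> simp_all

theorem key_injective : Function.Injective key := fun _ _ h =>
  expansion_injective (coord_injective (toLex_inj.1 h))

theorem coord_append_singleton_zero (x : List ℕ) (a : ℕ) : coord (x ++ [a]) 0 = a := by
  simp [coord]

theorem coord_append_singleton_succ (x : List ℕ) (a m : ℕ) :
    coord (x ++ [a]) (m + 1) = coord x m := by
  simp [coord]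

theorem gaps_append_singleton {x : List ℕ} (hx : x ≠ []) (a : ℕ) :
    gaps (x ++ [a]) = gaps x ++ [2 * (a - 1)] := by
  cases x <;> simp_all [gaps]

theorem exists_gaps_append_singleton (x : List ℕ) (a : ℕ) :
    ∃ P g, gaps (x ++ [a]) = P ++ [g] ∧ 2 * (a - 1) ≤ g ∧ g ≤ 2 * (a - 1) + 1 := by
  rcases eq_or_ne x [] with rfl | hx
  · exact ⟨[], _, rfl, by omega, le_rfl⟩
  · exact ⟨_, _, gaps_append_singleton hx a, le_rfl, by omega⟩

/-- If `x ◁ y`, then the gap of `x` is smaller at the last position where the gaps differ. -/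
theorem VecLT.exists_gaps {x y : List ℕ} (h : VecLT x y) (hx : x ≠ []) (hy : y ≠ [])
    (hx1 : ∀ a ∈ x, 1 ≤ a) : ∃ P P' S g g', gaps x = P ++ [g] ++ S ∧ gaps y = P' ++ [g'] ++ S ∧
      g < g' := by
  obtain ⟨r, he, hl⟩ := h
  induction x using List.reverseRecOn generalizing y r with
  | nil => simp at hx
  | append_singleton x a ih =>
    obtain ⟨y, b, rfl⟩ := List.eq_nil_or_concat y |>.resolve_left hy
    rw [List.concat_eq_append] at *
    have ha : 1 ≤ a := hx1 a (by simp)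
    cases r with
    | zero =>
      simp only [coord_append_singleton_zero, Nat.cast_lt] at hl
      obtain ⟨P, g, hg, -, h1⟩ := exists_gaps_append_singleton x a
      obtain ⟨P', g', hg', h2, -⟩ := exists_gaps_append_singleton y b
      exact ⟨P, P', [], g, g', by simp [hg], by simp [hg'], by omega⟩
    | succ r =>
      have h0 := he 0 (by omega)
      simp only [coord_append_singleton_zero, Nat.cast_inj] at h0
      subst h0
      rw [coord_append_singleton_succ, coord_append_singleton_succ] at hl
      have hx' : x ≠ [] := by
        rintro rfl
        simp [coord] at hl
      -- If `y` runs out first, `a` was its first coordinate and carries the extra 1. The gaps then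
      -- differ one place to the right of the coordinate that is compared with `∞`.
      rcases eq_or_ne y [] with rfl | hy'
      · exact ⟨gaps x, [], [], 2 * (a - 1), 2 * (a - 1) + 1, by simp [gaps_append_singleton hx'],
          by simp [gaps], by omega⟩
      · obtain ⟨P, P', S, g, g', h1, h2, h3⟩ := ih hx' hy' (fun z hz => hx1 z (by simp [hz])) r
          (fun m hm => by
            have := he (m + 1) (by omega)
            rwa [coord_append_singleton_succ, coord_append_singleton_succ] at this) hl
        exact ⟨P, P', S ++ [2 * (a - 1)], g, g', by simp [gaps_append_singleton hx', h1],
          by simp [gaps_append_singleton hy', h2], h3⟩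

/-- Exchanging two adjacent letters in the wrong order makes the number smaller. -/
theorem num_swap_lt {x y : QZ} (h : key y < key x) (u v : List QZ) :
    num (u ++ y :: x :: v) < num (u ++ x :: y :: v) := by
  obtain ⟨P, P', S, g, g', h1, h2, h3⟩ := (key_lt_key.1 h).exists_gaps (expansion_ne_nil y)
    (expansion_ne_nil x) (fun a ha => (two_le_of_mem_expansion y a ha).trans' (by omega))
  have e1 : wordGaps (u ++ y :: x :: v) =
      (wordGaps u ++ gaps (expansion y) ++ P') ++ [g'] ++ (S ++ wordGaps v) := by
    rw [show u ++ y :: x :: v = u ++ ([y] ++ ([x] ++ v)) by simp]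
    simp only [wordGaps_append, wordGaps_singleton, h2]
    simp
  have e2 : wordGaps (u ++ x :: y :: v) =
      (wordGaps u ++ gaps (expansion x) ++ P) ++ [g] ++ (S ++ wordGaps v) := by
    rw [show u ++ x :: y :: v = u ++ ([x] ++ ([y] ++ v)) by simp]
    simp only [wordGaps_append, wordGaps_singleton, h1]
    simp
  rw [num, num, e1, e2]
  refine val_lt_val ?_ ?_ h3
  · have := validGaps_wordGaps (u ++ y :: x :: v)
    rw [e1, List.append_assoc] at this
    exact this.append_left
  · rw [h1, h2]
    simp only [List.sum_append, List.sum_singleton]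
    omega

/-! ### Sorted words and orbits. -/

/-- The words whose letters are in increasing order. -/
def IsSorted (w : List QZ) : Prop := w.Pairwise fun g h => key g ≤ key h

theorem isSorted_of_num_le {w : List QZ} (h : ∀ v, v.Perm w → num w ≤ num v) : IsSorted w := by
  have htr : IsTrans QZ fun g h => key g ≤ key h := ⟨fun _ _ _ h1 h2 => h1.trans h2⟩
  refine List.isChain_iff_pairwise.1 (List.isChain_iff_forall_rel_of_append_cons_cons.2 ?_)
  rintro x y u v rfl
  by_contra hlt
  exact (num_swap_lt (not_le.1 hlt) u v).not_ge (h _ ((List.Perm.swap _ _ _).append_left u))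

theorem IsSorted.eq_of_perm {v w : List QZ} (hv : IsSorted v) (hw : IsSorted w)
    (h : v.Perm w) : v = w :=
  List.Perm.eq_of_pairwise (fun _ _ _ _ h1 h2 => key_injective (h1.antisymm h2)) hv hw h

/-- Both families have the same sorted form, so undoing one sort after the other gives the
permutation. The linear order is auxiliary; for letters it is that of `ℚ`, not `◁`. -/
theorem exists_perm_of_ofFn_perm {α : Type*} [LinearOrder α] {n : ℕ} {a b : Fin n → α}
    (h : (List.ofFn a).Perm (List.ofFn b)) : ∃ σ : Equiv.Perm (Fin n), b = a ∘ σ := by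
  have h1 : a ∘ Tuple.sort a = b ∘ Tuple.sort b := by
    apply List.ofFn_injective
    exact List.Perm.eq_of_sortedLE (Tuple.monotone_sort a).sortedLE_ofFn
      (Tuple.monotone_sort b).sortedLE_ofFn
      (((Tuple.sort a).ofFn_comp_perm a).trans (h.trans ((Tuple.sort b).ofFn_comp_perm b).symm))
  refine ⟨(Tuple.sort b).symm.trans (Tuple.sort a), ?_⟩
  funext i
  have := congrFun h1 ((Tuple.sort b).symm i)
  simpa using this.symm

theorem mem_orbit_iff {γ δ : Gamma} : δ ∈ orbit γ ↔ δ.toList.Perm γ.toList := by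
  constructor
  · rintro ⟨σ, rfl⟩
    have := σ.ofFn_comp_perm γ.toList.get
    rwa [List.ofFn_get] at this
  · intro h
    have hδ : δ.toList = List.ofFn fun i : Fin γ.toList.length =>
        δ.toList.get (i.cast h.length_eq.symm) := by
      apply List.ext_get <;> simp [h.length_eq]
    obtain ⟨σ, hσ⟩ := exists_perm_of_ofFn_perm (a := γ.toList.get)
      (b := fun i : Fin γ.toList.length => δ.toList.get (i.cast h.length_eq.symm))
      (by rw [← hδ, List.ofFn_get]; exact h.symm)
    refine ⟨σ, ?_⟩
    apply FreeMonoid.toList.injective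
    rw [hδ, hσ]
    rfl

theorem orbit_eq_orbit {γ δ : Gamma} : orbit γ = orbit δ ↔ γ.toList.Perm δ.toList := by
  constructor
  · intro h
    rw [← mem_orbit_iff, ← h, mem_orbit_iff]
  · intro h
    ext ε
    rw [mem_orbit_iff, mem_orbit_iff]
    exact ⟨fun h' => h'.trans h, fun h' => h'.trans h.symm⟩

theorem eq_num_of_isLeast {γ : Gamma} {n : ℕ} (h : IsLeast {m | orbit (proj m) = orbit γ} n) :
    n = num (proj n).toList ∧ IsSorted (proj n).toList := by
  have hn : n = num (proj n).toList :=
    (h.2 (by simpa [proj_num] using h.1)).antisymm (num_le rfl)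
  refine ⟨hn, isSorted_of_num_le fun v hv => ?_⟩
  rw [← hn]
  refine h.2 ?_
  rw [Set.mem_ofPred_eq, ← show orbit (proj n) = orbit γ from h.1, proj_num, orbit_eq_orbit]
  exact hv

theorem isCommEssential_iff {n : ℕ} : IsCommEssential n ↔ ∃ w, IsSorted w ∧ n = num w := by
  constructor
  · rintro ⟨γ, h⟩
    exact ⟨_, (eq_num_of_isLeast h).2, (eq_num_of_isLeast h).1⟩
  · rintro ⟨w, hw, rfl⟩
    -- Minimality of `num w` is not checked directly: the fibre has a least element, its word is
    -- sorted, and uniqueness of the sorted rearrangement identifies it with `w`.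
    have hne : {m | orbit (proj m) = orbit (FreeMonoid.ofList w)}.Nonempty :=
      ⟨num w, by rw [Set.mem_ofPred_eq, proj_num]⟩
    obtain ⟨m, hm⟩ : ∃ m, IsLeast {m | orbit (proj m) = orbit (FreeMonoid.ofList w)} m :=
      ⟨_, Nat.sInf_mem hne, fun _ h => Nat.sInf_le h⟩
    obtain ⟨h1, h2⟩ := eq_num_of_isLeast hm
    have h3 : (proj m).toList = w := h2.eq_of_perm hw (orbit_eq_orbit.1 hm.1)
    rw [h3] at h1
    exact ⟨_, h1 ▸ hm⟩

/-! ### Products, powers and `F`-primes in terms of words. -/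

theorem num_injective : Function.Injective num := fun v w h => by
  have := congrArg proj h
  rwa [proj_num, proj_num, FreeMonoid.ofList.apply_eq_iff_eq] at this

theorem essMul_num (v w : List QZ) : essMul (num v) (num w) = num (v ++ w) := by
  rw [essMul, proj_num, proj_num, theta_eq]
  rfl

theorem essProd_map_num (l : List (List QZ)) : essProd (l.map num) = num l.flatten := by
  have h : ∀ v, (l.map num).foldl essMul (num v) = num (v ++ l.flatten) := by
    induction l with
    | nil => simp
    | cons w l ih =>
      intro v
      rw [List.map_cons, List.foldl_cons, essMul_num, ih, List.flatten_cons, List.append_assoc]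
  exact h []

theorem essPow_num (g : QZ) (r : ℕ) : essPow (num [g]) r = num (List.replicate r g) := by
  rw [essPow, ← List.map_replicate, essProd_map_num, List.flatten_replicate_singleton]

theorem isFPrime_iff {n : ℕ} : IsFPrime n ↔ ∃ g, n = num [g] := by
  simp only [IsFPrime, isTheta_iff]
  rfl

theorem primeLT_num {g h : QZ} : PrimeLT (num [g]) (num [h]) ↔ key g < key h := by
  rw [key_lt_key]
  constructor
  · rintro ⟨g', h', hg, hh, x, y, hx, hy, hxy⟩
    rw [isTheta_iff] at hg hh
    obtain rfl : g = g' := by simpa using num_injective hg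
    obtain rfl : h = h' := by simpa using num_injective hh
    rw [isExpansion_iff] at hx hy
    rwa [hx, hy] at hxy
  · intro hlt
    exact ⟨g, h, isTheta_iff.2 rfl, isTheta_iff.2 rfl, _, _, isExpansion_iff.2 rfl,
      isExpansion_iff.2 rfl, hlt⟩

/-! ### Grouping equal letters into powers. -/

/-- The run-length encoding of a sorted word. -/
theorem IsSorted.exists_eq_flatMap_replicate {w : List QZ} (hw : IsSorted w) :
    ∃ l : List (QZ × ℕ), l.Pairwise (fun a b => key a.1 < key b.1) ∧ (∀ a ∈ l, 1 ≤ a.2) ∧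
      w = l.flatMap fun a => List.replicate a.2 a.1 := by
  induction w with
  | nil => exact ⟨[], by simp, by simp, rfl⟩
  | cons g w ih =>
    rw [IsSorted, List.pairwise_cons] at hw
    obtain ⟨l, hl, h1, rfl⟩ := ih hw.2
    have hmem : ∀ a ∈ l, key g ≤ key a.1 := fun a ha => hw.1 _ (by
      rw [List.mem_flatMap]
      refine ⟨a, ha, List.mem_replicate.2 ⟨?_, rfl⟩⟩
      have := h1 a ha
      omega)
    by_cases hg : ∃ r l', l = (g, r) :: l'
    · obtain ⟨r, l, rfl⟩ := hg
      rw [List.pairwise_cons] at hl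
      refine ⟨(g, r + 1) :: l, List.pairwise_cons.2 hl, fun a ha => ?_, by
        simp [List.replicate_succ]⟩
      rcases List.mem_cons.1 ha with rfl | ha
      · exact Nat.le_add_left _ _
      · exact h1 a (by simp [ha])
    · refine ⟨(g, 1) :: l, List.pairwise_cons.2 ⟨fun a ha => ?_, hl⟩, fun a ha => ?_, by simp⟩
      -- If `g` tied with any later run, it would tie with the first one too, by monotonicity, and
      -- hence equal its letter.
      · refine (hmem a ha).lt_of_ne fun he => hg ?_
        rcases l with - | ⟨⟨b, r⟩, l⟩
        · simp at ha
        · refine ⟨r, l, ?_⟩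
          suffices key g = key b by rw [key_injective this]
          refine (hmem (b, r) (by simp)).antisymm ?_
          rcases List.mem_cons.1 ha with rfl | ha
          · exact he.ge
          · exact ((List.pairwise_cons.1 hl).1 a ha).le.trans he.ge
      · rcases List.mem_cons.1 ha with rfl | ha
        · exact le_rfl
        · exact h1 a ha

theorem isSorted_flatten_ofFn_replicate {m : ℕ} {g : Fin m → QZ} (r : Fin m → ℕ)
    (h : ∀ i j, i < j → key (g i) < key (g j)) :
    IsSorted (List.ofFn fun i => List.replicate (r i) (g i)).flatten := by
  rw [IsSorted, List.pairwise_flatten, List.pairwise_ofFn]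
  constructor
  · intro l hl
    obtain ⟨i, rfl⟩ := (List.mem_ofFn' _ _).1 hl
    exact List.pairwise_replicate.2 (Or.inr le_rfl)
  · intro i j hij x hx y hy
    rw [List.eq_of_mem_replicate hx, List.eq_of_mem_replicate hy]
    exact (h i j hij).le

theorem essProd_ofFn_essPow {m : ℕ} (g : Fin m → QZ) (r : Fin m → ℕ) :
    essProd (List.ofFn fun i => essPow (num [g i]) (r i)) =
      num (List.ofFn fun i => List.replicate (r i) (g i)).flatten := by
  rw [← essProd_map_num, List.map_ofFn]
  simp only [essPow_num]
  rfl

end FibPart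

theorem theorem5p6 (n : ℕ) :
    FibPart.IsCommEssential n ↔
      ∃ (m : ℕ) (N r : Fin m → ℕ),
        (∀ i, FibPart.IsFPrime (N i)) ∧
        (∀ i j, i < j → FibPart.PrimeLT (N i) (N j)) ∧
        (∀ i, 1 ≤ r i) ∧
        n = FibPart.essProd (List.ofFn fun i => FibPart.essPow (N i) (r i)) := by
  rw [FibPart.isCommEssential_iff]
  constructor
  · rintro ⟨w, hw, rfl⟩
    obtain ⟨l, hl, h1, rfl⟩ := hw.exists_eq_flatMap_replicate
    refine ⟨l.length, fun i => FibPart.num [(l.get i).1], fun i => (l.get i).2,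
      fun i => FibPart.isFPrime_iff.2 ⟨_, rfl⟩, fun i j hij => ?_, fun i => h1 _ (l.get_mem i), ?_⟩
    · exact FibPart.primeLT_num.2 (List.pairwise_iff_get.1 hl i j hij)
    · rw [FibPart.essProd_ofFn_essPow, List.flatMap_def]
      congr 2
      conv_lhs => rw [← List.ofFn_get l, List.map_ofFn]
      rfl
  · rintro ⟨m, N, r, hN, hlt, -, rfl⟩
    choose g hg using fun i => FibPart.isFPrime_iff.1 (hN i)
    obtain rfl : N = fun i => FibPart.num [g i] := funext hg
    exact ⟨_, FibPart.isSorted_flatten_ofFn_replicate r fun i j hij =>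
      FibPart.primeLT_num.1 (hlt i j hij), FibPart.essProd_ofFn_essPow g r⟩
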